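/- **Theorem 1.9 (law of large numbers).** Let $d\ge 1$, let $\Omega=\{0,1\}^{\mathbb Z^d}$ with its product (Borel) $\sigma$-algebra, and for $x\in\mathbb Z^d$ let $\theta_x:\Omega\to\Omega$, $\theta_x(\omega)(y)=\omega(x+y)$. Let $Q$ be a probability measure on $\Omega$ such that (1) for each $i=1,\dots,d$, $Q$ is invariant and ergodic under $\theta_{e_i}$, where $e_i$ is the $i$-th unit vector; and (2) $Q(\mathcal P(\omega)=\emptyset)<1$, where $\mathcal P(\omega)=\{x\in\mathbb Z^d:\omega(x)=1\}$. Let $\Omega_0=\{\omega:\omega(0)=1\}$ (one has $Q(\Omega_0)>0$) and $P=Q(\,\cdot\mid\Omega_0)$. Let $\mathcal E=\{\pm e_1,\dots,\pm e_d\}$, and for $e\in\mathcal E$ put $f_e(\omega)=\min\{k\ge 1:\omega(ke)=1\}$, with $f_e(\omega)=\infty$ if there is no such $k$; for $Q$-almost every $\omega$, $f_e(\theta_v\omega)<\infty$ for all $v\in\mathbb Z^d$ and $e\in\mathcal E$. For such $\omega$ and $v\in\mathbb Z^d$ let $N_v(\omega)=\{v+f_e(\theta_v\omega)e:e\in\mathcal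 E\}$, a set of $2d$ points, and let $P_\omega$ be the law on $(\mathbb Z^d)^{\mathbb N}$ of the Markov chain $(X_n)_{n\ge 0}$ with $X_0=0$ and $$P_\omega(X_{n+1}=u\mid X_n=v)=\begin{cases}\frac1{2d}, & u\in N_v(\omega),\\ 0, & u\notin N_v(\omega).\end{cases}$$ Let $\mathbb P(G)=\int P_\omega(G)\,P(d\omega)$ be the annealed law of the walk, i.e. the marginal on $(\mathbb Z^d)^{\mathbb N}$ of the joint law $P\otimes P_\omega$. Then $$\mathbb P\Big(\lim_{n\to\infty}\frac{X_n}{n}=0\Big)=1,$$ and, moreover, $\mathbb E_P[f_e]<\infty$ for every $e\in\mathcal E$. -/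

import Mathlib

open MeasureTheory ProbabilityTheory Filter Topology
open scoped ENNReal

noncomputable section

namespace PointProcessWalk

/-- The lattice `ℤ^d`; its product σ-algebra is the discrete one. -/
abbrev Site (d : ℕ) : Type := Fin d → ℤ

/-- The environments `Ω = {0,1}^(ℤ^d)`, with the product σ-algebra, which is the Borel σ-algebra of
the product topology since `ℤ^d` is countable. -/
abbrev Env (d : ℕ) : Type := Site d → Bool

/-- Trajectories `(ℤ^d)^ℕ`, with the σ-algebra generated by the cylinder functions. -/
abbrev Path (d : ℕ) : Type := ℕ → Site d

/-- The index set of the `2d` coordinate directions `± e_i`. -/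
abbrev Dir (d : ℕ) : Type := Fin d × ℤˣ

variable {d : ℕ}

/-- The unit vector `± e_i`. -/
def Dir.vec (e : Dir d) : Site d := Pi.single e.1 (e.2 : ℤ)

/-- The shift `(θ_x ω)(y) = ω (x + y)`. -/
def shift (x : Site d) (ω : Env d) : Env d := fun y => ω (x + y)

/-- The set of points of the environment. -/
def points (ω : Env d) : Set (Site d) := {x | ω x = true}

/-- The law `Q` of a discrete point process: `Q` is stationary and ergodic under each of the `d`
unit translations separately, and the point set is not almost surely empty. -/
structure IsPointProcess (Q : Measure (Env d)) : Prop where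
  prob : IsProbabilityMeasure Q
  ergodic : ∀ i : Fin d, Ergodic (shift (Pi.single i 1)) Q
  nonempty : Q {ω | points ω = ∅} < 1

/-- The event `Ω₀` that the origin is a point of the environment. -/
def originEvent (d : ℕ) : Set (Env d) := {ω | ω 0 = true}

/-- The measure `P = Q( · | Ω₀)`. -/
def palm (Q : Measure (Env d)) : Measure (Env d) := Q[|originEvent d]

/-- The distance `f_e(ω) = min {k > 0 : ω (k e) = 1}`, with value `∞` if there is no such `k`. -/
def coordDist (e : Dir d) (ω : Env d) : ℕ∞ :=
  ⨅ (k : ℕ) (_ : 0 < k ∧ ω (k • e.vec) = true), (k : ℕ∞)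

/-- The coordinate nearest neighbour `v + f_e(θ_v ω) e` of `v` in direction `e`. If `f_e(θ_v ω) = ∞`,
which has probability zero for a point process as above, this is `v` by convention. -/
def neighbor (ω : Env d) (v : Site d) (e : Dir d) : Site d :=
  v + (coordDist e (shift v ω)).toNat • e.vec

/-- The set `N_v(ω)` of the coordinate nearest neighbours of `v`. -/
def neighbors (ω : Env d) (v : Site d) : Finset (Site d) := Finset.univ.image (neighbor ω v)

/-- The one-step transition law from `v` in the environment `ω`: a uniformly chosen one of the `2d`
directions is followed to the nearest neighbour. See `step_singleton` for the transition
probabilities. -/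
def step (ω : Env d) (v : Site d) : Measure (Site d) :=
  (2 * d : ℝ≥0∞)⁻¹ • ∑ e : Dir d, Measure.dirac (neighbor ω v e)

/-- If `v` has `2d` different neighbours, then each of them is chosen with probability `1 / (2d)`,
and all other points with probability `0`. -/
theorem step_singleton (ω : Env d) (v u : Site d) (h : (neighbors ω v).card = 2 * d) :
    step ω v {u} = if u ∈ neighbors ω v then (2 * d : ℝ≥0∞)⁻¹ else 0 := by
  classical
  have hinj : Set.InjOn (neighbor ω v) (Finset.univ : Finset (Dir d)) := by
    apply Finset.card_image_iff.1
    change (neighbors ω v).card = _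
    rw [h]
    simp [Finset.card_univ, mul_comm]
  have hsum : (∑ e : Dir d, Measure.dirac (neighbor ω v e)) {u}
      = ∑ w ∈ neighbors ω v, if w = u then (1 : ℝ≥0∞) else 0 := by
    rw [neighbors, Finset.sum_image hinj, Measure.finsetSum_apply]
    exact Finset.sum_congr rfl fun e _ => by simp [Set.indicator_apply]
  rw [step, Measure.smul_apply, hsum, Finset.sum_ite_eq']
  split_ifs <;> simp

theorem step_univ [NeZero d] (ω : Env d) (v : Site d) : step ω v Set.univ = 1 := by
  have h : (2 * d : ℝ≥0∞) ≠ 0 := by simp [NeZero.ne d]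
  have h' : (2 * d : ℝ≥0∞) ≠ ∞ := ENNReal.mul_ne_top (by simp) (by simp)
  simp [step, Finset.card_univ, mul_comm (d : ℝ≥0∞) 2, ENNReal.inv_mul_cancel h h']

/-- The transition kernel of the walk from time `n` to time `n + 1`, as a function of the past
`X_0, …, X_n`; it only depends on `X_n`. -/
def stepKernel (ω : Env d) (n : ℕ) : Kernel (Π _ : Finset.Iic n, Site d) (Site d) where
  toFun x := step ω (x ⟨n, Finset.mem_Iic.2 le_rfl⟩)
  measurable' := measurable_of_countable _

instance [NeZero d] (ω : Env d) (n : ℕ) : IsMarkovKernel (stepKernel ω n) :=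
  ⟨fun _ => ⟨step_univ _ _⟩⟩

/-- The quenched law `P_ω` of the walk: the law on `(ℤ^d)^ℕ` of the Markov chain that starts at `0`
and has transition law `step ω`. -/
def quenched [NeZero d] (ω : Env d) : Measure (Path d) :=
  Kernel.traj (X := fun _ => Site d) (stepKernel ω) 0 (fun _ => 0)

instance [NeZero d] (ω : Env d) : IsProbabilityMeasure (quenched ω) := by
  unfold quenched; infer_instance

theorem measurable_shift (v : Site d) : Measurable (shift v) :=
  measurable_pi_lambda _ fun y => measurable_pi_apply (v + y)

theorem measurable_coordDist (e : Dir d) : Measurable (coordDist e) := by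
  classical
  refine measurable_to_countable' fun m => ?_
  have hm : ∀ k : ℕ, MeasurableSet {ω : Env d | 0 < k ∧ ω (k • e.vec) = true} := by
    intro k
    have h : Measurable fun ω : Env d => ω (k • e.vec) := measurable_pi_apply _
    exact (MeasurableSet.const (0 < k)).inter (h (measurableSet_singleton true))
  have hlt : ∀ a : ℕ∞, MeasurableSet {ω : Env d | coordDist e ω < a} := by
    intro a
    have : {ω : Env d | coordDist e ω < a} =
        ⋃ k : ℕ, {ω : Env d | 0 < k ∧ ω (k • e.vec) = true} ∩ {_ω | (k : ℕ∞) < a} := by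
      ext ω
      simp [coordDist, iInf_lt_iff, and_assoc]
    rw [this]
    exact MeasurableSet.iUnion fun k => (hm k).inter (MeasurableSet.const _)
  have hle : MeasurableSet {ω : Env d | coordDist e ω ≤ m} := by
    have : {ω : Env d | coordDist e ω ≤ m} =
        {_ω | m = ⊤} ∪ {ω | coordDist e ω < m + 1} := by
      ext ω
      by_cases h : m = ⊤
      · simp [h]
      · simp [h, ENat.lt_add_one_iff h]
    rw [this]
    exact (MeasurableSet.const _).union (hlt _)
  convert hle.diff (hlt m) using 1
  ext ω
  simp [le_antisymm_iff]

theorem measurable_neighbor (v : Site d) (e : Dir d) :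
    Measurable fun ω : Env d => neighbor ω v e :=
  (measurable_of_countable fun m : ℕ∞ => v + m.toNat • e.vec).comp
    ((measurable_coordDist e).comp (measurable_shift v))

theorem measurable_step (v : Site d) (s : Set (Site d)) :
    Measurable fun ω : Env d => step ω v s := by
  simp only [step, Measure.smul_apply, Measure.finsetSum_apply, smul_eq_mul]
  exact Measurable.const_mul (Finset.measurable_sum _ fun e _ =>
    (Measure.measurable_coe MeasurableSet.of_discrete).comp
      (Measure.measurable_dirac.comp (measurable_neighbor v e))) _

theorem partialTraj_singleton [NeZero d] (ω : Env d) (n : ℕ) (x : Path d) :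
    Kernel.partialTraj (X := fun _ => Site d) (stepKernel ω) 0 n (fun _ => 0)
        {Preorder.frestrictLe n x} =
      (if x 0 = 0 then 1 else 0) * ∏ k ∈ Finset.range n, step ω (x k) {x (k + 1)} := by
  classical
  induction n with
  | zero =>
    rw [Kernel.partialTraj_self, Kernel.id_apply, Measure.dirac_apply' _ (measurableSet_singleton _)]
    have : ((fun _ => 0 : Π _ : Finset.Iic 0, Site d) = Preorder.frestrictLe 0 x) ↔ x 0 = 0 := by
      constructor
      · intro h
        exact (congrFun h ⟨0, by simp⟩).symm
      · intro h
        ext1 ⟨i, hi⟩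
        obtain rfl : i = 0 := by simpa using hi
        exact h.symm
    simp [Set.indicator_apply, this]
  | succ n ih =>
    rw [Kernel.partialTraj_succ_eq_comp (Nat.zero_le n),
      Kernel.comp_apply' _ _ _ (measurableSet_singleton _)]
    have key : ∀ z : (Π _ : Finset.Iic n, Site d),
        Kernel.partialTraj (X := fun _ => Site d) (stepKernel ω) n (n + 1) z
          {Preorder.frestrictLe (n + 1) x} =
        ({Preorder.frestrictLe n x} : Set (Π _ : Finset.Iic n, Site d)).indicator
          (fun _ => step ω (x n) {x (n + 1)}) z := by
      intro z
      have hpre : IicProdIoc (X := fun _ => Site d) n (n + 1) ⁻¹' {Preorder.frestrictLe (n + 1) x} =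
          {Preorder.frestrictLe n x} ×ˢ
            {MeasurableEquiv.piSingleton (X := fun _ => Site d) n (x (n + 1))} := by
        rw [← MeasurableEquiv.coe_IicProdIoc (Nat.le_succ n), ← MeasurableEquiv.coe_toEquiv,
          ← Equiv.image_symm_eq_preimage, Set.image_singleton, Set.singleton_prod_singleton]
        congr 1
        refine Prod.ext rfl ?_
        ext1 ⟨i, hi⟩
        obtain rfl : i = n + 1 := by
          have := Finset.mem_Ioc.1 hi
          omega
        rfl
      rw [Kernel.partialTraj_succ_self, Kernel.map_apply' _ (by fun_prop) _
        (measurableSet_singleton _), hpre, Kernel.prod_apply, Measure.prod_prod, Kernel.id_apply,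
        Measure.dirac_apply' _ (measurableSet_singleton _), Kernel.map_apply' _
        (MeasurableEquiv.measurable _) _ (measurableSet_singleton _)]
      have hpre' : MeasurableEquiv.piSingleton (X := fun _ => Site d) n ⁻¹'
          {MeasurableEquiv.piSingleton (X := fun _ => Site d) n (x (n + 1))} = {x (n + 1)} := by
        ext y
        simp
      rw [hpre']
      by_cases hz : z = Preorder.frestrictLe n x
      · subst hz
        simp [stepKernel]
      · simp [hz]
    simp_rw [key]
    rw [lintegral_indicator_const (measurableSet_singleton _), ih, Finset.prod_range_succ]
    ring

/-- The finite-dimensional distributions of the quenched law. -/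
theorem quenched_cylinder [NeZero d] (ω : Env d) (n : ℕ) (x : Path d) :
    quenched ω {X | ∀ k ≤ n, X k = x k} =
      (if x 0 = 0 then 1 else 0) * ∏ k ∈ Finset.range n, step ω (x k) {x (k + 1)} := by
  rw [← partialTraj_singleton, ← Kernel.traj_map_frestrictLe_apply,
    Measure.map_apply (by fun_prop) (measurableSet_singleton _), quenched]
  congr 1
  ext X
  simp [funext_iff, Preorder.frestrictLe]

/-- The quenched law depends measurably on the environment. -/
theorem measurable_quenched [NeZero d] : Measurable (quenched : Env d → Measure (Path d)) := by
  classical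
  refine Measurable.measure_of_isPiSystem_of_isProbabilityMeasure
    (generateFrom_measurableCylinders (α := fun _ : ℕ => Site d)).symm
    isPiSystem_measurableCylinders fun A hA => ?_
  obtain ⟨s, S, hS, rfl⟩ := (mem_measurableCylinders _).1 hA
  have hs : s ⊆ Finset.Iic (s.sup id) := s.subset_Iic_sup_id
  set n := s.sup id
  set T : Set (Π _ : Finset.Iic n, Site d) := Finset.restrict₂ (π := fun _ => Site d) hs ⁻¹' S
  have h : ∀ ω : Env d, quenched ω (cylinder s S) =
      ∑' y : (Π _ : Finset.Iic n, Site d), T.indicator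
        (fun y => (quenched ω).map (Preorder.frestrictLe n) {y}) y := by
    intro ω
    rw [Measure.tsum_indicator_apply_singleton _ _ MeasurableSet.of_discrete,
      Measure.map_apply (by fun_prop) MeasurableSet.of_discrete]
    rfl
  simp_rw [h]
  refine Measurable.tsum fun y => ?_
  by_cases hy : y ∈ T
  · simp only [Set.indicator_of_mem hy]
    have hx : ∃ x : Path d, Preorder.frestrictLe n x = y :=
      ⟨fun k => if hk : k ∈ Finset.Iic n then y ⟨k, hk⟩ else 0, by
        ext1 ⟨k, hk⟩
        simp only [Preorder.frestrictLe, Finset.restrict]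
        exact dif_pos hk⟩
    obtain ⟨x, rfl⟩ := hx
    simp_rw [quenched, Kernel.traj_map_frestrictLe_apply, partialTraj_singleton]
    exact Measurable.const_mul (Finset.measurable_prod _ fun k _ => measurable_step _ _) _
  · simp [Set.indicator_of_notMem hy]

/-- The quenched laws, as a Markov kernel from environments to trajectories. -/
def quenchedKernel (d : ℕ) [NeZero d] : Kernel (Env d) (Path d) := ⟨quenched, measurable_quenched⟩

/-- The joint law `P ⊗ P_ω` of the environment and the trajectory. -/
def jointLaw [NeZero d] (Q : Measure (Env d)) : Measure (Env d × Path d) :=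
  palm Q ⊗ₘ quenchedKernel d

/-- The annealed law of the walk: the marginal on the trajectories of the joint law. -/
def annealed [NeZero d] (Q : Measure (Env d)) : Measure (Path d) := (jointLaw Q).snd

end PointProcessWalk

end

/-!
The environment seen from a point of the configuration evolves, when the walker moves in direction
`e`, by the map `hop e`. On the event that the origin is a point, `hop e` is the first return map of
the shift by `e`, so that it preserves the Palm measure (`IsPointProcess.measurePreserving_hop`) and
inherits ergodicity from the shift (`IsPointProcess.ae_eq_const_of_hop`). Kac's inequality
`IsPointProcess.lintegral_coordDist_lt_top` gives the finite mean of `coordDist e`, and thereby also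
the almost sure existence of all nearest neighbours. As the nearest neighbour relation is symmetric,
`coordDist e.opp (hop e ω) = coordDist e ω`, and therefore opposite directions have the same mean
distance.

The quenched walk is driven by independent uniform directions (`quenched_eq_map_trajectory`). On
pairs of an environment and a sequence of directions, one step of the walk becomes the skew product
`skew`, and the `i`-th coordinate of the walk at time `n` becomes the Birkhoff sum of the function
`displacement i`, which is integrable and, by the symmetry of the distances, centred. It remains to
show that `skew` is ergodic (`IsPointProcess.ergodic_skew`) and to apply the pointwise ergodic
theorem (`ae_tendsto_birkhoffSum_div`). For the ergodicity, let `A` be an invariant event. Its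
conditional probability given the environment is harmonic, that is, equal to its average over the
`2d` maps `hop e`. By strict convexity of `L²` it is invariant under each of them
(`ae_comp_eq_of_sum_comp_eq`), so that it is constant. Then `A` is independent of any finite number
of directions given the environment, hence of itself.
-/

namespace PointProcessWalk

/-! ### The pointwise ergodic theorem for centred functions -/

section Birkhoff

variable {α : Type*}

/-- The running maximum `max_{0 ≤ k ≤ n} S_k` of the Birkhoff sums `S_k` of `f` along `T`, where
`S_0 = 0`, through the recursion that comes from `S_{k+1} = f + S_k ∘ T`. -/
def birkhoffMax (T : α → α) (f : α → ℝ) : ℕ → α → ℝ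
  | 0, _ => 0
  | n + 1, x => max 0 (f x + birkhoffMax T f n (T x))

theorem birkhoffMax_nonneg (T : α → α) (f : α → ℝ) (n : ℕ) (x : α) : 0 ≤ birkhoffMax T f n x := by
  cases n
  · exact le_rfl
  · exact le_max_left _ _

theorem birkhoffMax_le_succ (T : α → α) (f : α → ℝ) (n : ℕ) (x : α) :
    birkhoffMax T f n x ≤ birkhoffMax T f (n + 1) x := by
  induction n generalizing x with
  | zero => exact birkhoffMax_nonneg T f 1 x
  | succ n ih => exact max_le_max le_rfl (add_le_add le_rfl (ih (T x)))

theorem monotone_birkhoffMax (T : α → α) (f : α → ℝ) (x : α) :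
    Monotone fun n => birkhoffMax T f n x :=
  monotone_nat_of_le_succ fun n => birkhoffMax_le_succ T f n x

theorem birkhoffSum_le_birkhoffMax (T : α → α) (f : α → ℝ) (n : ℕ) (x : α) :
    birkhoffSum T f n x ≤ birkhoffMax T f n x := by
  induction n generalizing x with
  | zero => simp [birkhoffMax]
  | succ n ih =>
    rw [birkhoffSum_succ']
    exact le_max_of_le_right (add_le_add le_rfl (ih (T x)))

variable [MeasurableSpace α] {μ : Measure α} {T : α → α} {f : α → ℝ}

theorem measurable_birkhoffMax (hT : Measurable T) (hf : Measurable f) (n : ℕ) :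
    Measurable (birkhoffMax T f n) := by
  induction n with
  | zero => exact measurable_const
  | succ n ih => exact measurable_const.max (hf.add (ih.comp hT))

theorem integrable_birkhoffMax [IsFiniteMeasure μ] (hT : MeasurePreserving T μ μ)
    (hf : Integrable f μ) (n : ℕ) : Integrable (birkhoffMax T f n) μ := by
  induction n with
  | zero => exact integrable_const 0
  | succ n ih => exact (integrable_const 0).sup (hf.add (hT.integrable_comp_of_integrable ih))

/-- If the Birkhoff sums were unbounded on a set of positive measure, then, by ergodicity, the
running maximum `M_n` would tend to infinity almost everywhere. But then
`M_{n+1} - M_n ∘ T = max (-M_n ∘ T) f` converges to `f`, whose integral is negative, although the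
integrals are nonnegative because `M_n ≤ M_{n+1}` and `T` preserves the measure. -/
theorem ae_bddAbove_birkhoffSum [IsFiniteMeasure μ] (hT : Ergodic T μ) (hfm : Measurable f)
    (hf : Integrable f μ) (hneg : ∫ x, f x ∂μ < 0) :
    ∀ᵐ x ∂μ, ∃ C : ℝ, ∀ n, birkhoffSum T f n x ≤ C := by
  have hTm : Measurable T := hT.toMeasurePreserving.measurable
  set A : Set α := {x | ∀ c : ℕ, ∃ n, (c : ℝ) < birkhoffMax T f n x} with hA
  have hAm : MeasurableSet A := by
    have : A = ⋂ c : ℕ, ⋃ n, {x | (c : ℝ) < birkhoffMax T f n x} := by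
      ext x
      simp [hA]
    rw [this]
    exact .iInter fun c => .iUnion fun n =>
      measurableSet_lt measurable_const (measurable_birkhoffMax hTm hfm n)
  have hinv : T ⁻¹' A = A := by
    ext x
    constructor
    · intro h c
      obtain ⟨c', hc'⟩ := exists_nat_gt ((c : ℝ) - f x)
      obtain ⟨n, hn⟩ := h c'
      exact ⟨n + 1, lt_max_of_lt_right (by linarith)⟩
    · intro h c
      obtain ⟨c', hc'⟩ := exists_nat_gt (max 0 ((c : ℝ) + f x))
      obtain ⟨n, hn⟩ := h c'
      have h1 := (birkhoffMax_le_succ T f n x).trans_lt' hn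
      rcases lt_max_iff.1 h1 with h0 | h0
      · exact absurd h0 (not_lt.2 (Nat.cast_nonneg _))
      · exact ⟨n, by linarith [le_max_right 0 ((c : ℝ) + f x)]⟩
  rcases hT.toPreErgodic.ae_mem_or_ae_notMem hAm hinv with hfull | hnull
  · exfalso
    have hD : ∀ n x, birkhoffMax T f (n + 1) x - birkhoffMax T f n (T x)
        = max (-birkhoffMax T f n (T x)) (f x) := by
      intro n x
      rw [birkhoffMax, ← max_sub_sub_right]
      simp
    have hint : ∀ n, 0 ≤ ∫ x, max (-birkhoffMax T f n (T x)) (f x) ∂μ := by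
      intro n
      have hi := integrable_birkhoffMax hT.toMeasurePreserving hf n
      have hiT : Integrable (fun x => birkhoffMax T f n (T x)) μ :=
        hT.toMeasurePreserving.integrable_comp_of_integrable hi
      simp_rw [← hD]
      rw [integral_sub (integrable_birkhoffMax hT.toMeasurePreserving hf (n + 1)) hiT,
        ← integral_map (f := birkhoffMax T f n) hTm.aemeasurable
          (by rw [hT.toMeasurePreserving.map_eq]; exact hi.aestronglyMeasurable),
        hT.toMeasurePreserving.map_eq, sub_nonneg]
      exact integral_mono hi (integrable_birkhoffMax hT.toMeasurePreserving hf (n + 1))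
        fun x => birkhoffMax_le_succ T f n x
    have hlim : Tendsto (fun n => ∫ x, max (-birkhoffMax T f n (T x)) (f x) ∂μ) atTop
        (𝓝 (∫ x, f x ∂μ)) := by
      refine tendsto_integral_of_dominated_convergence (fun x => |f x|)
        (fun n => ?_) hf.abs (fun n => ae_of_all _ fun x => ?_) ?_
      · exact ((((measurable_birkhoffMax hTm hfm n).comp hTm).neg).max hfm).aestronglyMeasurable
      · rw [Real.norm_eq_abs, abs_le]
        exact ⟨(neg_abs_le _).trans (le_max_right _ _), max_le
          ((neg_nonpos.2 (birkhoffMax_nonneg _ _ _ _)).trans (abs_nonneg _)) (le_abs_self _)⟩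
      · filter_upwards [hfull] with x hx
        have hx' : T x ∈ A := by rw [← hinv] at hx; exact hx
        obtain ⟨c, hc⟩ := exists_nat_gt (-f x)
        obtain ⟨n, hn⟩ := hx' c
        refine tendsto_const_nhds.congr' ?_
        filter_upwards [eventually_ge_atTop n] with m hm
        have := monotone_birkhoffMax T f (T x) hm
        dsimp only at this
        exact (max_eq_right (by linarith)).symm
    exact absurd (ge_of_tendsto' hlim hint) (not_le.2 hneg)
  · filter_upwards [hnull] with x hx
    simp only [hA, Set.mem_ofPred_eq, not_forall, not_exists, not_lt] at hx
    obtain ⟨c, hc⟩ := hx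
    exact ⟨c, fun n => (birkhoffSum_le_birkhoffMax T f n x).trans (hc n)⟩

/-- The upper half of the pointwise ergodic theorem. -/
theorem ae_eventually_birkhoffSum_le [IsProbabilityMeasure μ] (hT : Ergodic T μ)
    (hfm : Measurable f) (hf : Integrable f μ) (h0 : ∫ x, f x ∂μ = 0) :
    ∀ᵐ x ∂μ, ∀ ε > 0, ∀ᶠ n : ℕ in atTop, (n : ℝ)⁻¹ * birkhoffSum T f n x ≤ ε := by
  -- Subtracting `1 / (k + 1)` makes the mean negative.
  have hk : ∀ k : ℕ, ∀ᵐ x ∂μ, ∃ C : ℝ, ∀ n,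
      birkhoffSum T (fun x => f x - 1 / ((k : ℝ) + 1)) n x ≤ C := by
    intro k
    refine ae_bddAbove_birkhoffSum hT (hfm.sub_const _) (hf.sub (integrable_const _)) ?_
    rw [integral_sub hf (integrable_const _), h0]
    simp
    positivity
  filter_upwards [ae_all_iff.2 hk] with x hx ε hε
  obtain ⟨k, hk⟩ := exists_nat_one_div_lt (half_pos hε)
  obtain ⟨C, hC⟩ := hx k
  have hlim : Tendsto (fun n : ℕ => (n : ℝ)⁻¹ * C) atTop (𝓝 0) := by
    simpa using (tendsto_inv_atTop_nhds_zero_nat (𝕜 := ℝ)).mul_const C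
  filter_upwards [hlim.eventually (gt_mem_nhds (half_pos hε)), eventually_gt_atTop 0] with n hn hn0
  have hn0' : (0 : ℝ) < n := Nat.cast_pos.2 hn0
  have h1 : birkhoffSum T f n x ≤ C + n * (1 / ((k : ℝ) + 1)) := by
    have := hC n
    simp only [birkhoffSum, Finset.sum_sub_distrib, Finset.sum_const, Finset.card_range,
      nsmul_eq_mul] at this ⊢
    linarith
  calc (n : ℝ)⁻¹ * birkhoffSum T f n x ≤ (n : ℝ)⁻¹ * (C + n * (1 / ((k : ℝ) + 1))) := by gcongr
    _ = (n : ℝ)⁻¹ * C + 1 / ((k : ℝ) + 1) := by field_simp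
    _ ≤ ε := by linarith

/-- The pointwise ergodic theorem for an ergodic transformation and a centred integrable
function. -/
theorem ae_tendsto_birkhoffSum_div [IsProbabilityMeasure μ] (hT : Ergodic T μ)
    (hfm : Measurable f) (hf : Integrable f μ) (h0 : ∫ x, f x ∂μ = 0) :
    ∀ᵐ x ∂μ, Tendsto (fun n : ℕ => (n : ℝ)⁻¹ * birkhoffSum T f n x) atTop (𝓝 0) := by
  filter_upwards [ae_eventually_birkhoffSum_le hT hfm hf h0,
    ae_eventually_birkhoffSum_le (f := -f) hT hfm.neg hf.neg (by simp [integral_neg, h0])]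
    with x h1 h2
  rw [Metric.tendsto_nhds]
  intro ε hε
  filter_upwards [h1 _ (half_pos hε), h2 _ (half_pos hε)] with n hn1 hn2
  rw [birkhoffSum_neg, mul_neg] at hn2
  rw [Real.dist_eq, sub_zero, abs_lt]
  constructor <;> linarith

end Birkhoff

/-! ### Nearest neighbours and the first return maps -/

variable {d : ℕ}

theorem shift_zero (ω : Env d) : shift 0 ω = ω := by
  funext y
  simp [shift]

theorem shift_shift (x y : Site d) (ω : Env d) : shift y (shift x ω) = shift (x + y) ω := by
  funext z
  simp [shift, add_assoc]

/-- The direction `-e`. -/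
def Dir.opp (e : Dir d) : Dir d := (e.1, -e.2)

theorem Dir.vec_opp (e : Dir d) : e.opp.vec = -e.vec := by
  simp [Dir.opp, Dir.vec, Pi.single_neg]

theorem Dir.opp_opp (e : Dir d) : e.opp.opp = e := by
  simp [Dir.opp]

theorem lt_coordDist_iff (e : Dir d) (ω : Env d) (k : ℕ) :
    (k : ℕ∞) < coordDist e ω ↔ ∀ j : ℕ, 0 < j → j ≤ k → ω (j • e.vec) = false := by
  rw [← not_le, ← ENat.lt_add_one_iff (ENat.natCast_ne_top k), coordDist]
  simp only [iInf_lt_iff, not_exists, not_lt]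
  constructor
  · intro h j hj hjk
    by_contra hω
    have := h j ⟨hj, by simpa using hω⟩
    norm_cast at this
    omega
  · intro h j hj
    by_contra hlt
    norm_cast at hlt
    have := h j hj.1 (by omega)
    rw [hj.2] at this
    exact absurd this (by simp)

theorem coordDist_eq_coe_iff (e : Dir d) (ω : Env d) (k : ℕ) :
    coordDist e ω = k ↔
      0 < k ∧ ω (k • e.vec) = true ∧ ∀ j : ℕ, 0 < j → j < k → ω (j • e.vec) = false := by
  have hle : coordDist e ω ≤ k ↔ ¬ ∀ j : ℕ, 0 < j → j ≤ k → ω (j • e.vec) = false := by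
    rw [← lt_coordDist_iff, not_lt]
  cases k with
  | zero =>
    have := (lt_coordDist_iff e ω 0).2 (by omega)
    simpa using this.ne'
  | succ k =>
    have hlt : ((k + 1 : ℕ) : ℕ∞) ≤ coordDist e ω ↔
        ∀ j : ℕ, 0 < j → j ≤ k → ω (j • e.vec) = false := by
      rw [← lt_coordDist_iff, Nat.cast_add_one, ENat.add_one_le_iff (ENat.natCast_ne_top k)]
    rw [le_antisymm_iff, hle, hlt]
    simp only [Nat.lt_succ_iff]
    constructor
    · rintro ⟨h1, h2⟩
      refine ⟨Nat.zero_le k, ?_, h2⟩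
      by_contra h
      refine h1 fun j hj hjk => ?_
      rcases Nat.le_succ_iff.1 hjk with hjk | rfl
      · exact h2 j hj hjk
      · exact Bool.eq_false_of_not_eq_true h
    · rintro ⟨-, h1, h2⟩
      refine ⟨fun h => ?_, h2⟩
      rw [h (k + 1) (by omega) le_rfl] at h1
      exact absurd h1 (by simp)

theorem coordDist_shift {e : Dir d} {ω : Env d} (h : ω e.vec = false) :
    coordDist e ω = coordDist e (shift e.vec ω) + 1 := by
  have key : ∀ k : ℕ, coordDist e ω = (k + 1 : ℕ) ↔ coordDist e (shift e.vec ω) = k := by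
    intro k
    simp only [coordDist_eq_coe_iff, shift, ← succ_nsmul']
    constructor
    · rintro ⟨-, h1, h2⟩
      refine ⟨Nat.pos_of_ne_zero ?_, h1, fun j hj hjk => h2 _ (by omega) (by omega)⟩
      rintro rfl
      simp [h] at h1
    · rintro ⟨h0, h1, h2⟩
      refine ⟨by omega, h1, fun j hj hjk => ?_⟩
      obtain ⟨i, rfl⟩ := Nat.exists_eq_succ_of_ne_zero hj.ne'
      rcases Nat.eq_zero_or_pos i with rfl | hi
      · simpa using h
      · exact h2 i hi (by omega)
  by_cases htop : coordDist e (shift e.vec ω) = ⊤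
  · rw [htop, top_add]
    by_contra hne
    obtain ⟨k, hk⟩ := ENat.ne_top_iff_exists.1 hne
    cases k with
    | zero => exact absurd ((coordDist_eq_coe_iff e ω 0).1 hk.symm).1 (lt_irrefl _)
    | succ k =>
      rw [(key k).1 hk.symm] at htop
      exact ENat.natCast_ne_top k htop
  · obtain ⟨k, hk⟩ := ENat.ne_top_iff_exists.1 htop
    rw [← hk, (key k).2 hk.symm, Nat.cast_add_one]

/-- The origin is a point, and its nearest neighbour in direction `e` is at distance `k`. -/
def gapEvent (e : Dir d) (k : ℕ) : Set (Env d) := {ω | ω 0 = true ∧ coordDist e ω = k}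

/-- Looking back from the nearest neighbour in direction `e`, the origin is its nearest neighbour
in direction `-e`. -/
theorem shift_preimage_gapEvent_opp (e : Dir d) (k : ℕ) :
    shift (k • e.vec) ⁻¹' gapEvent e.opp k = gapEvent e k := by
  ext ω
  have hj : ∀ j ≤ k, k • e.vec + j • e.opp.vec = (k - j) • e.vec := by
    intro j hj
    obtain ⟨i, rfl⟩ := Nat.exists_eq_add_of_le hj
    rw [Dir.vec_opp, Nat.add_sub_cancel_left, add_smul, smul_neg]
    abel
  simp only [gapEvent, Set.mem_preimage, Set.mem_ofPred_eq, coordDist_eq_coe_iff, shift, add_zero]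
  rw [hj k le_rfl, Nat.sub_self, zero_smul]
  constructor
  · rintro ⟨h1, h2, h3, h4⟩
    refine ⟨h3, h2, h1, fun j hj0 hjk => ?_⟩
    have := h4 (k - j) (by omega) (by omega)
    rwa [hj _ (by omega), show k - (k - j) = j by omega] at this
  · rintro ⟨h1, h2, h3, h4⟩
    refine ⟨h3, h2, h1, fun j hj0 hjk => ?_⟩
    rw [hj _ (by omega)]
    exact h4 _ (by omega) (by omega)

/-- The environment seen from the nearest neighbour of the origin in direction `e`; on
`originEvent d` this is the first return map of the shift by `e`. Without a neighbour, that is for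
`coordDist e ω = ⊤`, it is the identity, like `neighbor`. -/
noncomputable def hop (e : Dir d) (ω : Env d) : Env d := shift ((coordDist e ω).toNat • e.vec) ω

theorem hop_eq_shift {e : Dir d} {ω : Env d} {k : ℕ} (h : coordDist e ω = k) :
    hop e ω = shift (k • e.vec) ω := by
  simp [hop, h]

theorem shift_neighbor (ω : Env d) (v : Site d) (e : Dir d) :
    shift (neighbor ω v e) ω = hop e (shift v ω) := by
  rw [hop, shift_shift, neighbor]

theorem coordDist_opp_hop {e : Dir d} {ω : Env d} (h0 : ω 0 = true) (h : coordDist e ω ≠ ⊤) :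
    coordDist e.opp (hop e ω) = coordDist e ω := by
  obtain ⟨k, hk⟩ := ENat.ne_top_iff_exists.1 h
  rw [hop_eq_shift hk.symm]
  have : ω ∈ gapEvent e k := ⟨h0, hk.symm⟩
  rw [← shift_preimage_gapEvent_opp] at this
  rw [← hk]
  exact this.2

theorem measurableSet_originEvent : MeasurableSet (originEvent d) :=
  (measurable_pi_apply (0 : Site d) : Measurable fun ω : Env d => ω 0)
    (measurableSet_singleton true)

theorem measurableSet_gapEvent (e : Dir d) (k : ℕ) : MeasurableSet (gapEvent e k) :=
  measurableSet_originEvent.inter (measurable_coordDist e (measurableSet_singleton (k : ℕ∞)))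

theorem measurable_hop (e : Dir d) : Measurable (hop e) := by
  have h : Measurable fun p : Site d × Env d => shift p.1 p.2 :=
    measurable_from_prod_countable_right fun x => measurable_shift x
  exact h.comp (((measurable_of_countable fun m : ℕ∞ => m.toNat • e.vec).comp
    (measurable_coordDist e)).prodMk measurable_id)

theorem palm_absolutelyContinuous (Q : Measure (Env d)) : palm Q ≪ Q :=
  cond_absolutelyContinuous

namespace IsPointProcess

variable {Q : Measure (Env d)}

theorem measurePreserving_shift (hQ : IsPointProcess Q) (x : Site d) :
    MeasurePreserving (shift x) Q Q := by
  let G : AddSubgroup (Site d) :=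
    { carrier := {x | MeasurePreserving (shift x) Q Q}
      zero_mem' := by
        have : (shift 0 : Env d → Env d) = id := funext shift_zero
        simpa [this] using MeasurePreserving.id Q
      add_mem' := fun {x y} hx hy => by
        have : (shift (x + y) : Env d → Env d) = shift y ∘ shift x :=
          funext fun ω => (shift_shift x y ω).symm
        simpa [this] using MeasurePreserving.comp hy hx
      neg_mem' := fun {x} hx => by
        refine ⟨measurable_shift _, ?_⟩
        have h1 : (shift (-x) : Env d → Env d) ∘ shift x = id :=
          funext fun ω => by simp [shift_shift, shift_zero]
        conv_lhs => rw [← MeasurePreserving.map_eq hx]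
        rw [Measure.map_map (measurable_shift _) (measurable_shift _), h1, Measure.map_id] }
  have hx : x = ∑ i, x i • (Pi.single i 1 : Site d) := by
    funext j
    simp [Finset.sum_apply, Pi.single_apply]
  have : x ∈ G := by
    rw [hx]
    exact sum_mem fun i _ => zsmul_mem (hQ.ergodic i).toMeasurePreserving _
  exact this

/-- By stationarity, all sites are occupied with the same probability. -/
theorem originEvent_ne_zero (hQ : IsPointProcess Q) : Q (originEvent d) ≠ 0 := by
  intro h
  have := hQ.prob
  have hx : ∀ x : Site d, ∀ᵐ ω ∂Q, ω x ≠ true := by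
    intro x
    have h1 := (hQ.measurePreserving_shift x).measure_preimage
      measurableSet_originEvent.nullMeasurableSet
    rw [h] at h1
    rw [ae_iff]
    convert h1 using 2
    ext ω
    simp [originEvent, shift]
  have h1 : (Set.univ : Set (Env d)) =ᵐ[Q] {ω | points ω = ∅} := by
    filter_upwards [ae_all_iff.2 hx] with ω hω
    refine propext (iff_of_true trivial ?_)
    exact Set.eq_empty_of_forall_notMem hω
  have h2 := hQ.nonempty
  rw [← measure_congr h1, measure_univ] at h2
  exact lt_irrefl _ h2

theorem isProbabilityMeasure_palm (hQ : IsPointProcess Q) : IsProbabilityMeasure (palm Q) := by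
  have := hQ.prob
  exact cond_isProbabilityMeasure hQ.originEvent_ne_zero

theorem ae_palm_iff (hQ : IsPointProcess Q) {p : Env d → Prop} :
    (∀ᵐ ω ∂palm Q, p ω) ↔ ∀ᵐ ω ∂Q, ω 0 = true → p ω := by
  have := hQ.prob
  rw [palm, ProbabilityTheory.cond, Measure.ae_ennreal_smul_measure_iff (by simp),
    ae_restrict_iff' measurableSet_originEvent]
  rfl

theorem ae_palm_mem (hQ : IsPointProcess Q) : ∀ᵐ ω ∂palm Q, ω 0 = true :=
  hQ.ae_palm_iff.2 (ae_of_all _ fun _ h => h)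

/-- Shift the event that the origin is a point and that its nearest neighbour in direction `e` is at
distance more than `k` by `k e`: it becomes the event that the nearest point to the origin in
direction `-e`, the origin included, is at distance exactly `k`. These events are disjoint. -/
theorem tsum_measure_lt_coordDist_le_one (hQ : IsPointProcess Q) (e : Dir d) :
    ∑' k : ℕ, Q (originEvent d ∩ {ω | (k : ℕ∞) < coordDist e ω}) ≤ 1 := by
  have := hQ.prob
  have hm : ∀ k : ℕ, MeasurableSet (originEvent d ∩ {ω | (k : ℕ∞) < coordDist e ω}) := fun k =>
    measurableSet_originEvent.inter
      (measurable_coordDist e (Set.to_countable (Set.Ioi (k : ℕ∞))).measurableSet)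
  calc ∑' k : ℕ, Q (originEvent d ∩ {ω | (k : ℕ∞) < coordDist e ω})
      = ∑' k : ℕ, Q (shift (-(k • e.vec)) ⁻¹'
          (originEvent d ∩ {ω | (k : ℕ∞) < coordDist e ω})) :=
        tsum_congr fun k => ((hQ.measurePreserving_shift _).measure_preimage
          (hm k).nullMeasurableSet).symm
    _ = Q (⋃ k : ℕ, shift (-(k • e.vec)) ⁻¹'
          (originEvent d ∩ {ω | (k : ℕ∞) < coordDist e ω})) := by
        refine (measure_iUnion ?_ fun k => measurable_shift _ (hm k)).symm
        refine (pairwise_disjoint_on _).2 fun k l hkl => Set.disjoint_left.2 fun ω hk hl => ?_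
        have h1 : ω (-(k • e.vec)) = true := by
          have : shift (-(k • e.vec)) ω 0 = true := hk.1
          simpa [shift] using this
        have h2 := (lt_coordDist_iff _ _ _).1 hl.2 (l - k) (by omega) (by omega)
        have h3 : -(l • e.vec) + (l - k) • e.vec = -(k • e.vec) := by
          obtain ⟨i, rfl⟩ := Nat.exists_eq_add_of_le hkl.le
          rw [Nat.add_sub_cancel_left, add_smul]
          abel
        rw [shift, h3, h1] at h2
        exact absurd h2 (by simp)
    _ ≤ 1 := prob_le_one

/-- One half of Kac's formula. -/
theorem lintegral_coordDist_lt_top (hQ : IsPointProcess Q) (e : Dir d) :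
    ∫⁻ ω, (coordDist e ω : ℝ≥0∞) ∂palm Q < ∞ := by
  have := hQ.prob
  have hcoe : ∀ n : ℕ∞, (n : ℝ≥0∞) = ∑' k : ℕ, if (k : ℕ∞) < n then (1 : ℝ≥0∞) else 0 := by
    intro n
    induction n using ENat.recTopCoe with
    | top => simp
    | coe n =>
      rw [tsum_eq_sum (s := Finset.range n) (by intro k hk; simpa using hk)]
      rw [Finset.sum_congr rfl (g := fun _ => (1 : ℝ≥0∞)) (by intro k hk; simpa using hk)]
      simp
  have hm : ∀ k : ℕ, MeasurableSet {ω : Env d | (k : ℕ∞) < coordDist e ω} := fun k =>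
    measurable_coordDist e (Set.to_countable (Set.Ioi (k : ℕ∞))).measurableSet
  have hsum : ∫⁻ ω in originEvent d, (coordDist e ω : ℝ≥0∞) ∂Q ≤ 1 := by
    simp_rw [hcoe]
    rw [lintegral_tsum fun k => (Measurable.ite (hm k) measurable_const
      measurable_const).aemeasurable]
    refine le_trans (ENNReal.tsum_le_tsum fun k => ?_) (hQ.tsum_measure_lt_coordDist_le_one e)
    rw [Set.inter_comm, ← Measure.restrict_apply (hm k), ← lintegral_indicator_one (hm k)]
    exact le_of_eq (lintegral_congr fun ω => by simp [Set.indicator_apply])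
  rw [palm, ProbabilityTheory.cond, lintegral_smul_measure]
  exact ENNReal.mul_lt_top (by simpa [pos_iff_ne_zero] using hQ.originEvent_ne_zero)
    (hsum.trans_lt ENNReal.one_lt_top)

theorem ae_coordDist_ne_top (hQ : IsPointProcess Q) (e : Dir d) :
    ∀ᵐ ω ∂palm Q, coordDist e ω ≠ ⊤ := by
  have hm : Measurable fun ω : Env d => (coordDist e ω : ℝ≥0∞) :=
    (measurable_of_countable fun n : ℕ∞ => (n : ℝ≥0∞)).comp (measurable_coordDist e)
  filter_upwards [ae_lt_top hm (hQ.lintegral_coordDist_lt_top e).ne] with ω hω h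
  simp [h] at hω

theorem measure_originEvent_inter (hQ : IsPointProcess Q) (e : Dir d) {C : Set (Env d)}
    (hC : MeasurableSet C) :
    Q (originEvent d ∩ C) = ∑' k : ℕ, Q (gapEvent e k ∩ C) := by
  rw [← measure_iUnion _ fun k => (measurableSet_gapEvent e k).inter hC]
  · refine measure_congr ?_
    filter_upwards [hQ.ae_palm_iff.1 (hQ.ae_coordDist_ne_top e)] with ω hω
    refine propext ⟨fun h => ?_, fun h => ?_⟩
    · obtain ⟨k, hk⟩ := ENat.ne_top_iff_exists.1 (hω h.1)
      exact Set.mem_iUnion.2 ⟨k, ⟨h.1, hk.symm⟩, h.2⟩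
    · obtain ⟨k, hk⟩ := Set.mem_iUnion.1 h
      exact ⟨hk.1.1, hk.2⟩
  · refine fun k l hkl => Set.disjoint_left.2 fun ω hk hl => hkl ?_
    have := hk.1.2.symm.trans hl.1.2
    exact_mod_cast this

/-- The first return map preserves the Palm measure: on the event that the return time is `k`, it is
the shift by `k e`, which carries this event onto the event that the last visit was `k` steps
ago. -/
theorem measurePreserving_hop (hQ : IsPointProcess Q) (e : Dir d) :
    MeasurePreserving (hop e) (palm Q) (palm Q) := by
  refine ⟨measurable_hop e, Measure.ext fun B hB => ?_⟩
  rw [Measure.map_apply (measurable_hop e) hB, palm, cond_apply measurableSet_originEvent,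
    cond_apply measurableSet_originEvent, hQ.measure_originEvent_inter e (measurable_hop e hB),
    hQ.measure_originEvent_inter e.opp hB]
  congr 1
  refine tsum_congr fun k => ?_
  rw [← (hQ.measurePreserving_shift (k • e.vec)).measure_preimage
    ((measurableSet_gapEvent e.opp k).inter hB).nullMeasurableSet, Set.preimage_inter,
    shift_preimage_gapEvent_opp]
  congr 1
  ext ω
  refine and_congr_right fun h => ?_
  rw [Set.mem_preimage, hop_eq_shift h.2]
  rfl

theorem lintegral_coordDist_opp (hQ : IsPointProcess Q) (e : Dir d) :
    ∫⁻ ω, (coordDist e.opp ω : ℝ≥0∞) ∂palm Q = ∫⁻ ω, (coordDist e ω : ℝ≥0∞) ∂palm Q := by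
  have hm : Measurable fun ω : Env d => (coordDist e.opp ω : ℝ≥0∞) :=
    (measurable_of_countable fun n : ℕ∞ => (n : ℝ≥0∞)).comp (measurable_coordDist e.opp)
  rw [← (hQ.measurePreserving_hop e).lintegral_comp hm]
  refine lintegral_congr_ae ?_
  filter_upwards [hQ.ae_palm_mem, hQ.ae_coordDist_ne_top e] with ω h0 h
  rw [coordDist_opp_hop h0 h]

/-- The first return map of an ergodic shift is ergodic. The invariant function `h` on `originEvent`
is extended to all environments by its value at the next point in direction `e`, and this extension
is invariant under the shift. -/
theorem ae_eq_const_of_hop (hQ : IsPointProcess Q) (i : Fin d) {h : Env d → ℝ} (hm : Measurable h)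
    (hinv : ∀ᵐ ω ∂palm Q, h (hop (i, 1) ω) = h ω) : ∃ c, ∀ᵐ ω ∂palm Q, h ω = c := by
  classical
  set e : Dir d := (i, 1)
  have he : e.vec = Pi.single i 1 := by simp [e, Dir.vec]
  -- Without a case distinction, `g` would not be invariant where there is no point in direction `e`,
  -- and that this is a null event is only known on `originEvent`.
  set g : Env d → ℝ := fun ω => if coordDist e ω = ⊤ then 0 else h (hop e ω) with hg
  have hgm : Measurable g := Measurable.ite (measurable_coordDist e (measurableSet_singleton ⊤))
    measurable_const (hm.comp (measurable_hop e))
  have hfin := hQ.ae_palm_iff.1 (hQ.ae_coordDist_ne_top e)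
  have hginv : g ∘ shift e.vec =ᵐ[Q] g := by
    have hq := (hQ.measurePreserving_shift e.vec).quasiMeasurePreserving
    filter_upwards [hq.ae (hQ.ae_palm_iff.1 hinv), hq.ae hfin] with ω h1 h2
    cases hω : ω e.vec with
    | true =>
      have h0 : shift e.vec ω 0 = true := by simpa [shift] using hω
      have hk : coordDist e ω = (1 : ℕ) :=
        (coordDist_eq_coe_iff e ω 1).2 ⟨one_pos, by simpa using hω, by omega⟩
      have hne : coordDist e ω ≠ ⊤ := by simp [hk]
      simp only [hg, Function.comp_apply, if_neg (h2 h0), h1 h0, if_neg hne]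
      rw [hop_eq_shift hk, one_smul]
    | false =>
      have hd := coordDist_shift hω
      by_cases htop : coordDist e (shift e.vec ω) = ⊤
      · have : coordDist e ω = ⊤ := by rw [hd, htop, top_add]
        simp [hg, htop, this]
      · obtain ⟨k, hk⟩ := ENat.ne_top_iff_exists.1 htop
        have hk' : coordDist e ω = (k + 1 : ℕ) := by rw [hd, ← hk, Nat.cast_add_one]
        have hne : coordDist e ω ≠ ⊤ := by rw [hk']; exact ENat.natCast_ne_top _
        simp only [hg, Function.comp_apply, if_neg htop, if_neg hne]
        rw [hop_eq_shift hk', hop_eq_shift hk.symm, shift_shift, succ_nsmul']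
  rw [he] at hginv
  obtain ⟨c, hc⟩ := (hQ.ergodic i).ae_eq_const_of_ae_eq_comp₀ hgm.nullMeasurable hginv
  refine ⟨c, ?_⟩
  filter_upwards [(palm_absolutelyContinuous Q).ae_le hc, hinv, hQ.ae_coordDist_ne_top e]
    with ω h1 h2 h3
  rw [← h2]
  simpa [hg, h3] using h1

end IsPointProcess

/-! ### The skew product and its ergodicity -/

section AverageFixed

variable {α ι : Type*} [MeasurableSpace α] {μ : Measure α} [IsFiniteMeasure μ] [Fintype ι]
  {φ : ι → α → α} {h : α → ℝ}

/-- A bounded harmonic function of a random composition of measure-preserving maps is invariant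
under each of them: the composition operators are isometries of the strictly convex space `L²`. -/
theorem ae_comp_eq_of_sum_comp_eq (hφ : ∀ a, MeasurePreserving (φ a) μ μ) (hm : Measurable h)
    (hb : ∀ x, |h x| ≤ 1) (hav : ∀ x, ∑ a, h (φ a x) = Fintype.card ι * h x) (a : ι) :
    ∀ᵐ x ∂μ, h (φ a x) = h x := by
  have hi : Integrable (fun x => h x ^ 2) μ :=
    Integrable.of_bound (hm.pow_const 2).aestronglyMeasurable 1 (ae_of_all _ fun x => by
      rw [Real.norm_eq_abs, abs_pow]
      exact pow_le_one₀ (abs_nonneg _) (hb x))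
  have hic : ∀ a, Integrable (fun x => h (φ a x) ^ 2) μ := fun a =>
    (hφ a).integrable_comp_of_integrable hi
  have hexp : ∀ x, ∑ a, (h (φ a x) - h x) ^ 2
      = ∑ a, h (φ a x) ^ 2 - Fintype.card ι * h x ^ 2 := by
    intro x
    calc ∑ a, (h (φ a x) - h x) ^ 2
        = ∑ a, h (φ a x) ^ 2 - 2 * h x * ∑ a, h (φ a x) + Fintype.card ι * h x ^ 2 := by
          simp only [sub_sq, Finset.sum_add_distrib, Finset.sum_sub_distrib, Finset.mul_sum,
            Finset.sum_const, Finset.card_univ, nsmul_eq_mul]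
          congr 2
          exact Finset.sum_congr rfl fun _ _ => by ring
      _ = _ := by rw [hav]; ring
  have hint : ∀ a, ∫ x, h (φ a x) ^ 2 ∂μ = ∫ x, h x ^ 2 ∂μ := fun a => by
    rw [← integral_map (f := fun x => h x ^ 2) (hφ a).measurable.aemeasurable
      (hm.pow_const 2).aestronglyMeasurable, (hφ a).map_eq]
  have hzero : ∫ x, ∑ a, (h (φ a x) - h x) ^ 2 ∂μ = 0 := by
    simp_rw [hexp]
    rw [integral_sub (integrable_finsetSum _ fun a _ => hic a) (hi.const_mul _),
      integral_finsetSum _ fun a _ => hic a, integral_const_mul]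
    simp [hint, Finset.card_univ]
  have hisum : Integrable (fun x => ∑ a, (h (φ a x) - h x) ^ 2) μ := by
    simp_rw [hexp]
    exact (integrable_finsetSum _ fun a _ => hic a).sub (hi.const_mul _)
  have hnn : 0 ≤ fun x => ∑ a, (h (φ a x) - h x) ^ 2 := fun x =>
    Finset.sum_nonneg fun a _ => sq_nonneg _
  filter_upwards [(integral_eq_zero_iff_of_nonneg hnn hisum).1 hzero] with x hx
  have := (Finset.sum_eq_zero_iff_of_nonneg fun a _ => sq_nonneg (h (φ a x) - h x)).1 hx a
    (Finset.mem_univ a)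
  exact sub_eq_zero.1 (pow_eq_zero_iff two_ne_zero |>.1 this)

end AverageFixed

section Sequences

variable {X : Type*}

/-- The sequence with first term `a`, followed by `t`. -/
def consSeq (a : X) (t : ℕ → X) : ℕ → X
  | 0 => a
  | n + 1 => t n

theorem consSeq_mem_pi_range_iff (a : X) (t : ℕ → X) (n : ℕ) (B : ℕ → Set X) :
    consSeq a t ∈ (Finset.range (n + 1) : Set ℕ).pi B ↔
      a ∈ B 0 ∧ t ∈ (Finset.range n : Set ℕ).pi fun k => B (k + 1) := by
  simp only [Set.mem_pi, Finset.coe_range, Set.mem_Iio]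
  constructor
  · exact fun h => ⟨h 0 (by omega), fun k hk => h (k + 1) (by omega)⟩
  · rintro ⟨h0, h1⟩ k hk
    cases k with
    | zero => exact h0
    | succ k => exact h1 k (by omega)

variable [MeasurableSpace X]

theorem measurable_consSeq : Measurable fun p : X × (ℕ → X) => consSeq p.1 p.2 := by
  refine measurable_pi_lambda _ fun n => ?_
  cases n with
  | zero => exact measurable_fst
  | succ n => exact (measurable_pi_apply n).comp measurable_snd

/-- To identify a product measure on sequences, it suffices to consider boxes that constrain an
initial segment. -/
theorem eq_infinitePi_of_range {μ : Measure X} [IsProbabilityMeasure μ] {ν : Measure (ℕ → X)}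
    (h : ∀ (n : ℕ) (B : ℕ → Set X), (∀ k, MeasurableSet (B k)) →
      ν ((Finset.range n : Set ℕ).pi B) = ∏ k ∈ Finset.range n, μ (B k)) :
    ν = Measure.infinitePi fun _ => μ := by
  classical
  refine Measure.eq_infinitePi _ fun s B hB => ?_
  obtain ⟨n, hn⟩ := s.exists_nat_subset_range
  have h1 : (s : Set ℕ).pi B
      = (Finset.range n : Set ℕ).pi fun k => if k ∈ s then B k else Set.univ := by
    ext t
    simp only [Set.mem_pi, Finset.mem_coe]
    constructor
    · intro ht k _
      split_ifs with hk
      · exact ht k hk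
      · trivial
    · intro ht k hk
      simpa [hk] using ht k (hn hk)
  rw [h1, h n _ fun k => by split_ifs; exacts [hB k, .univ]]
  rw [← Finset.prod_subset hn]
  · exact Finset.prod_congr rfl fun k hk => by simp [hk]
  · intro k _ hk
    simp [hk]

theorem map_consSeq_infinitePi (μ : Measure X) [IsProbabilityMeasure μ] :
    (μ.prod (Measure.infinitePi fun _ : ℕ => μ)).map (fun p => consSeq p.1 p.2)
      = Measure.infinitePi fun _ => μ := by
  refine eq_infinitePi_of_range fun n B hB => ?_
  rw [Measure.map_apply measurable_consSeq
    (MeasurableSet.pi (Finset.countable_toSet _) fun k _ => hB k)]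
  cases n with
  | zero => simp
  | succ n =>
    have : (fun p : X × (ℕ → X) => consSeq p.1 p.2) ⁻¹' (Finset.range (n + 1) : Set ℕ).pi B
        = B 0 ×ˢ (Finset.range n : Set ℕ).pi fun k => B (k + 1) := by
      ext p
      exact consSeq_mem_pi_range_iff _ _ _ _
    rw [this, Measure.prod_prod, Measure.infinitePi_pi _ fun k _ => hB (k + 1),
      Finset.prod_range_succ', mul_comm]

end Sequences

section Directions

instance : MeasurableSingletonClass ℤˣ :=
  ⟨fun u => ⟨{(u : ℤ)}, .of_discrete, by ext v; simp [Units.ext_iff]⟩⟩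

variable (d : ℕ)

/-- The uniform distribution on the `2d` directions. -/
noncomputable def dirLaw : Measure (Dir d) :=
  (2 * d : ℝ≥0∞)⁻¹ • ∑ e : Dir d, Measure.dirac e

instance [NeZero d] : IsProbabilityMeasure (dirLaw d) := by
  refine ⟨?_⟩
  have h : (2 * d : ℝ≥0∞) ≠ 0 := by simp [NeZero.ne d]
  have h' : (2 * d : ℝ≥0∞) ≠ ∞ := ENNReal.mul_ne_top (by simp) (by simp)
  simp [dirLaw, Finset.card_univ, mul_comm (d : ℝ≥0∞) 2, ENNReal.inv_mul_cancel h h']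

/-- The law of the directions of the successive steps of the walk: an independent sequence of
uniform directions. -/
noncomputable def dirSeqLaw [NeZero d] : Measure (ℕ → Dir d) := Measure.infinitePi fun _ => dirLaw d

instance [NeZero d] : IsProbabilityMeasure (dirSeqLaw d) := by
  unfold dirSeqLaw; infer_instance

variable {d} [NeZero d]

/-- Conditioning on the first direction. -/
theorem dirSeqLaw_apply {A : Set (ℕ → Dir d)} (hA : MeasurableSet A) :
    dirSeqLaw d A = (2 * d : ℝ≥0∞)⁻¹ * ∑ a : Dir d, dirSeqLaw d {t | consSeq a t ∈ A} := by
  conv_lhs => rw [dirSeqLaw, ← map_consSeq_infinitePi]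
  rw [Measure.map_apply measurable_consSeq hA, Measure.prod_apply (measurable_consSeq hA), dirLaw,
    lintegral_smul_measure, lintegral_finsetSum_measure]
  simp only [lintegral_dirac]
  rfl

end Directions

section SkewProduct

variable {d : ℕ}

/-- One step of the walk, in terms of the environment seen from the walker and of the sequence of
the directions that it is going to follow. -/
noncomputable def skew (p : Env d × (ℕ → Dir d)) : Env d × (ℕ → Dir d) :=
  (hop (p.2 0) p.1, fun n => p.2 (n + 1))

theorem measurable_skew : Measurable (skew (d := d)) := by
  have h : Measurable fun p : Dir d × Env d => hop p.1 p.2 :=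
    measurable_from_prod_countable_right fun e => measurable_hop e
  have h0 : Measurable fun p : Env d × (ℕ → Dir d) => (p.2 0, p.1) :=
    ((measurable_pi_apply 0).comp measurable_snd).prodMk measurable_fst
  have h1 : Measurable fun p : Env d × (ℕ → Dir d) => fun n => p.2 (n + 1) :=
    measurable_pi_lambda _ fun n => (measurable_pi_apply (n + 1)).comp measurable_snd
  exact (h.comp h0).prodMk h1

variable [NeZero d] {Q : Measure (Env d)}

/-- The conditional probability of `A` given the environment. -/
noncomputable def sectionProb (A : Set (Env d × (ℕ → Dir d))) (ω : Env d) : ℝ≥0∞ :=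
  dirSeqLaw d (Prod.mk ω ⁻¹' A)

theorem measurable_sectionProb {A : Set (Env d × (ℕ → Dir d))} (hA : MeasurableSet A) :
    Measurable (sectionProb A) :=
  measurable_measure_prodMk_left hA

theorem sectionProb_preimage_skew {A : Set (Env d × (ℕ → Dir d))} (hA : MeasurableSet A)
    (ω : Env d) :
    sectionProb (skew ⁻¹' A) ω = (2 * d : ℝ≥0∞)⁻¹ * ∑ a : Dir d, sectionProb A (hop a ω) := by
  rw [sectionProb, dirSeqLaw_apply (measurable_prodMk_left (measurable_skew hA))]
  rfl

namespace IsPointProcess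

theorem measurePreserving_skew (hQ : IsPointProcess Q) :
    MeasurePreserving skew ((palm Q).prod (dirSeqLaw d)) ((palm Q).prod (dirSeqLaw d)) := by
  have := hQ.isProbabilityMeasure_palm
  refine ⟨measurable_skew, Measure.ext fun A hA => ?_⟩
  have hm := measurable_sectionProb hA
  have h : (2 * d : ℝ≥0∞) ≠ 0 := by simp [NeZero.ne d]
  have h' : (2 * d : ℝ≥0∞) ≠ ∞ := ENNReal.mul_ne_top (by simp) (by simp)
  rw [Measure.map_apply measurable_skew hA, Measure.prod_apply hA,
    Measure.prod_apply (measurable_skew hA)]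
  change ∫⁻ ω, sectionProb (skew ⁻¹' A) ω ∂palm Q = ∫⁻ ω, sectionProb A ω ∂palm Q
  simp_rw [sectionProb_preimage_skew hA]
  have hma : ∀ a, Measurable fun ω => sectionProb A (hop a ω) := fun a => hm.comp (measurable_hop a)
  rw [lintegral_const_mul _ (Finset.measurable_sum _ fun a _ => hma a),
    lintegral_finsetSum _ fun a _ => hma a]
  simp_rw [(hQ.measurePreserving_hop _).lintegral_comp hm]
  rw [Finset.sum_const, Finset.card_univ, nsmul_eq_mul, ← mul_assoc]
  simp [mul_comm (d : ℝ≥0∞) 2, ENNReal.inv_mul_cancel h h']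

/-- The conditional probability of an invariant event is a harmonic function of the environment, so
that it is invariant under each of the maps `hop e`, which are ergodic. -/
theorem sectionProb_ae_eq_const (hQ : IsPointProcess Q) {A : Set (Env d × (ℕ → Dir d))}
    (hA : MeasurableSet A) (hinv : skew ⁻¹' A = A) :
    ∃ c, ∀ᵐ ω ∂palm Q, sectionProb A ω = c := by
  have := hQ.isProbabilityMeasure_palm
  have hle : ∀ ω, sectionProb A ω ≤ 1 := fun ω => prob_le_one
  have hne : ∀ ω, sectionProb A ω ≠ ∞ := fun ω => measure_ne_top _ _
  have hav : ∀ ω, ∑ a : Dir d, (sectionProb A (hop a ω)).toReal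
      = Fintype.card (Dir d) * (sectionProb A ω).toReal := by
    intro ω
    have h2d : (2 * d : ℝ) ≠ 0 := by simp [NeZero.ne d]
    have h1 := congrArg ENNReal.toReal (sectionProb_preimage_skew hA ω)
    rw [hinv, ENNReal.toReal_mul, ENNReal.toReal_sum fun a _ => hne _] at h1
    rw [h1]
    simp only [ENNReal.toReal_inv, ENNReal.toReal_mul, ENNReal.toReal_ofNat, ENNReal.toReal_natCast,
      Fintype.card_prod, Fintype.card_fin, Fintype.card_units_int, Nat.cast_mul, Nat.cast_ofNat,
      mul_comm (d : ℝ) 2]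
    rw [mul_inv_cancel_left₀ h2d]
  have hm := (measurable_sectionProb hA).ennreal_toReal
  obtain ⟨c, hc⟩ := hQ.ae_eq_const_of_hop 0 hm
    (ae_comp_eq_of_sum_comp_eq hQ.measurePreserving_hop hm
    (fun ω => by
      rw [abs_of_nonneg ENNReal.toReal_nonneg]
      exact ENNReal.toReal_le_of_le_ofReal zero_le_one (by simpa using hle ω)) hav (0, 1))
  refine ⟨ENNReal.ofReal c, hc.mono fun ω hω => ?_⟩
  rw [← hω, ENNReal.ofReal_toReal (hne ω)]

/-- An invariant event whose conditional probability given the environment is constant is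
independent of the first directions of the walk, given the environment. -/
theorem ae_dirSeqLaw_inter (hQ : IsPointProcess Q) {A : Set (Env d × (ℕ → Dir d))}
    (hA : MeasurableSet A) (hinv : skew ⁻¹' A = A) {c : ℝ≥0∞}
    (hc : ∀ᵐ ω ∂palm Q, sectionProb A ω = c) (n : ℕ) :
    ∀ᵐ ω ∂palm Q, ∀ B : ℕ → Set (Dir d),
      dirSeqLaw d ((Finset.range n : Set ℕ).pi B ∩ Prod.mk ω ⁻¹' A)
        = c * dirSeqLaw d ((Finset.range n : Set ℕ).pi B) := by
  classical
  have hpi : ∀ (n : ℕ) (B : ℕ → Set (Dir d)), MeasurableSet ((Finset.range n : Set ℕ).pi B) :=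
    fun n B => MeasurableSet.pi (Finset.countable_toSet _) fun _ _ => .of_discrete
  induction n with
  | zero =>
    filter_upwards [hc] with ω hω B
    simpa [sectionProb] using hω
  | succ n ih =>
    filter_upwards [ae_all_iff.2 fun a =>
      (hQ.measurePreserving_hop a).quasiMeasurePreserving.ae ih] with ω hω B
    rw [dirSeqLaw_apply ((hpi _ _).inter (measurable_prodMk_left hA)), dirSeqLaw_apply (hpi _ _),
      mul_left_comm, Finset.mul_sum _ _ c]
    congr 1
    refine Finset.sum_congr rfl fun a _ => ?_
    have hmem : ∀ t, (ω, consSeq a t) ∈ A ↔ (hop a ω, t) ∈ A := by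
      intro t
      conv_lhs => rw [← hinv]
      rfl
    simp only [Set.mem_inter_iff, consSeq_mem_pi_range_iff, Set.mem_preimage, hmem]
    by_cases ha : a ∈ B 0
    · simp only [ha, true_and]
      exact hω a fun k => B (k + 1)
    · simp [ha]

/-- Given the environment, an invariant event is independent of all directions of the walk, and
therefore of itself. -/
theorem ergodic_skew (hQ : IsPointProcess Q) : Ergodic skew ((palm Q).prod (dirSeqLaw d)) := by
  have := hQ.isProbabilityMeasure_palm
  refine ⟨hQ.measurePreserving_skew, ⟨fun A hA hinv => eventuallyConst_set.2 ?_⟩⟩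
  obtain ⟨c, hc⟩ := hQ.sectionProb_ae_eq_const hA hinv
  rcases eq_or_ne c 0 with rfl | hc0
  · right
    exact (Measure.measure_prod_null hA).2 hc |> measure_eq_zero_iff_ae_notMem.1
  · left
    refine (Measure.ae_prod_mem_iff_ae_ae_mem hA).2 ?_
    filter_upwards [hc, ae_all_iff.2 (hQ.ae_dirSeqLaw_inter hA hinv hc)] with ω hω h
    have hAω : MeasurableSet (Prod.mk ω ⁻¹' A) := measurable_prodMk_left hA
    have hctop : c ≠ ∞ := hω ▸ measure_ne_top _ _
    have heq : c⁻¹ • (dirSeqLaw d).restrict (Prod.mk ω ⁻¹' A) = dirSeqLaw d := by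
      refine eq_infinitePi_of_range fun n B hB => ?_
      rw [Measure.smul_apply, Measure.restrict_apply' hAω, h n B, smul_eq_mul,
        ENNReal.inv_mul_cancel_left' (by simp [hc0]) (by simp [hctop]),
        dirSeqLaw, Measure.infinitePi_pi _ fun k _ => hB k]
    rw [ae_iff]
    change dirSeqLaw d (Prod.mk ω ⁻¹' A)ᶜ = 0
    rw [← heq, Measure.smul_apply, Measure.restrict_apply' hAω]
    simp

end IsPointProcess

end SkewProduct

/-! ### The law of large numbers -/

section Displacement

variable {d : ℕ}

/-- The `i`-th coordinate of the first step of the walk. -/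
noncomputable def displacement (i : Fin d) (p : Env d × (ℕ → Dir d)) : ℝ :=
  (((coordDist (p.2 0) p.1).toNat • (p.2 0).vec) i : ℤ)

theorem displacement_eq (i : Fin d) (p : Env d × (ℕ → Dir d)) :
    displacement i p = ((p.2 0).vec i : ℝ) * (coordDist (p.2 0) p.1 : ℝ≥0∞).toReal := by
  have h : ∀ n : ℕ∞, (n : ℝ≥0∞).toReal = n.toNat := fun n => by
    induction n using ENat.recTopCoe <;> simp
  rw [h, displacement]
  simp [mul_comm]

theorem measurable_displacement (i : Fin d) : Measurable (displacement i) := by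
  have h0 : Measurable fun p : Env d × (ℕ → Dir d) => p.2 0 :=
    (measurable_pi_apply 0).comp measurable_snd
  have h1 : Measurable fun p : Dir d × Env d => coordDist p.1 p.2 :=
    measurable_from_prod_countable_right measurable_coordDist
  have h2 : Measurable fun p : Env d × (ℕ → Dir d) => coordDist (p.2 0) p.1 :=
    h1.comp (h0.prodMk measurable_fst)
  have h3 : Measurable fun n : ℕ∞ => (n : ℝ≥0∞).toReal := measurable_of_countable _
  have h4 : Measurable fun e : Dir d => (e.vec i : ℝ) := measurable_of_countable _
  rw [funext (displacement_eq i)]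
  exact (h4.comp h0).mul (h3.comp h2)

theorem Dir.abs_vec_le_one (e : Dir d) (i : Fin d) : |(e.vec i : ℝ)| ≤ 1 := by
  rcases e with ⟨j, u⟩
  rcases Int.units_eq_one_or u with rfl | rfl <;> by_cases h : i = j <;>
    simp [Dir.vec, h]

namespace IsPointProcess

variable {Q : Measure (Env d)}

theorem integrable_coordDist (hQ : IsPointProcess Q) (e : Dir d) :
    Integrable (fun ω => (coordDist e ω : ℝ≥0∞).toReal) (palm Q) :=
  integrable_toReal_of_lintegral_ne_top
    ((measurable_of_countable fun n : ℕ∞ => (n : ℝ≥0∞)).comp (measurable_coordDist e)).aemeasurable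
    (hQ.lintegral_coordDist_lt_top e).ne

theorem integral_coordDist_opp (hQ : IsPointProcess Q) (e : Dir d) :
    ∫ ω, (coordDist e.opp ω : ℝ≥0∞).toReal ∂palm Q
      = ∫ ω, (coordDist e ω : ℝ≥0∞).toReal ∂palm Q := by
  have hm : ∀ e : Dir d, AEMeasurable (fun ω : Env d => (coordDist e ω : ℝ≥0∞)) (palm Q) :=
    fun e => ((measurable_of_countable fun n : ℕ∞ => (n : ℝ≥0∞)).comp
      (measurable_coordDist e)).aemeasurable
  have hfin : ∀ e : Dir d, ∀ᵐ ω ∂palm Q, (coordDist e ω : ℝ≥0∞) < ∞ := fun e =>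
    ae_lt_top' (hm e) (hQ.lintegral_coordDist_lt_top e).ne
  rw [integral_toReal (hm _) (hfin _), integral_toReal (hm _) (hfin _), hQ.lintegral_coordDist_opp]

variable [NeZero d]

theorem integrable_displacement (hQ : IsPointProcess Q) (i : Fin d) :
    Integrable (displacement i) ((palm Q).prod (dirSeqLaw d)) := by
  have := hQ.isProbabilityMeasure_palm
  have h : Integrable (fun ω => ∑ e : Dir d, (coordDist e ω : ℝ≥0∞).toReal) (palm Q) :=
    integrable_finsetSum _ fun e _ => hQ.integrable_coordDist e
  refine (h.comp_fst (dirSeqLaw d)).mono' (measurable_displacement i).aestronglyMeasurable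
    (ae_of_all _ fun p => ?_)
  rw [displacement_eq, Real.norm_eq_abs, abs_mul, abs_of_nonneg (a := ENNReal.toReal _)
    ENNReal.toReal_nonneg]
  calc |((p.2 0).vec i : ℝ)| * (coordDist (p.2 0) p.1 : ℝ≥0∞).toReal
      ≤ 1 * (coordDist (p.2 0) p.1 : ℝ≥0∞).toReal :=
        mul_le_mul_of_nonneg_right (Dir.abs_vec_le_one _ _) ENNReal.toReal_nonneg
    _ ≤ ∑ e : Dir d, (coordDist e p.1 : ℝ≥0∞).toReal := by
        rw [one_mul]
        exact Finset.single_le_sum (f := fun e => (coordDist e p.1 : ℝ≥0∞).toReal)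
          (fun e _ => ENNReal.toReal_nonneg) (Finset.mem_univ _)

/-- The mean displacements in opposite directions cancel. -/
theorem integral_displacement (hQ : IsPointProcess Q) (i : Fin d) :
    ∫ p, displacement i p ∂(palm Q).prod (dirSeqLaw d) = 0 := by
  have := hQ.isProbabilityMeasure_palm
  set m : Dir d → ℝ := fun e =>
    (e.vec i : ℝ) * ∫ ω, (coordDist e ω : ℝ≥0∞).toReal ∂palm Q with hm
  have hsum : ∑ e, m e = 0 := by
    have h1 : ∑ e : Dir d, m e.opp = ∑ e, m e :=
      Equiv.sum_comp (Function.Involutive.toPerm Dir.opp Dir.opp_opp) m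
    have h2 : ∀ e : Dir d, m e.opp = -m e := fun e => by
      simp [hm, hQ.integral_coordDist_opp, Dir.vec_opp]
    simp only [h2, Finset.sum_neg_distrib] at h1
    linarith
  rw [integral_prod_symm _ (hQ.integrable_displacement i)]
  simp only [displacement_eq, integral_const_mul]
  change ∫ t : ℕ → Dir d, m (t 0) ∂dirSeqLaw d = 0
  have hmap : (dirSeqLaw d).map (fun t => t 0) = dirLaw d :=
    Measure.infinitePi_map_eval (fun _ : ℕ => dirLaw d) 0
  have hint := integral_map (μ := dirSeqLaw d) (f := m) (φ := fun t : ℕ → Dir d => t 0)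
    (measurable_pi_apply 0).aemeasurable (measurable_of_countable m).aestronglyMeasurable
  rw [← hint, hmap, dirLaw, integral_smul_measure,
    integral_finsetSum_measure fun e _ => integrable_dirac (by simp)]
  simp [hsum]

end IsPointProcess

end Displacement

section Trajectory

variable {d : ℕ}

/-- The trajectory that starts at `v` and follows the directions `t`. -/
noncomputable def trajectory (ω : Env d) (v : Site d) (t : ℕ → Dir d) : ℕ → Site d
  | 0 => v
  | n + 1 => neighbor ω (trajectory ω v t n) (t n)

theorem trajectory_succ (ω : Env d) (v : Site d) (t : ℕ → Dir d) (n : ℕ) :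
    trajectory ω v t (n + 1) = trajectory ω (neighbor ω v (t 0)) (fun k => t (k + 1)) n := by
  induction n with
  | zero => rfl
  | succ n ih => rw [trajectory, ih, trajectory]

theorem measurable_trajectory (ω : Env d) (v : Site d) : Measurable (trajectory ω v) := by
  refine measurable_pi_lambda _ fun n => ?_
  induction n with
  | zero => exact measurable_const
  | succ n ih =>
    exact (measurable_of_countable fun p : Site d × Dir d => neighbor ω p.1 p.2).comp
      (ih.prodMk (measurable_pi_apply n))

theorem trajectory_eq_birkhoffSum (ω : Env d) (v : Site d) (t : ℕ → Dir d) (n : ℕ) (i : Fin d) :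
    (trajectory ω v t n i : ℝ) = v i + birkhoffSum skew (displacement i) n (shift v ω, t) := by
  induction n generalizing v t with
  | zero => simp [trajectory]
  | succ n ih =>
    rw [trajectory_succ, ih, birkhoffSum_succ', shift_neighbor, ← add_assoc]
    simp [neighbor, displacement, skew]

theorem measurableSet_tendsto_div :
    MeasurableSet {X : Path d | Tendsto (fun n : ℕ => (n : ℝ)⁻¹ • (fun i : Fin d => (X n i : ℝ)))
      atTop (𝓝 0)} := by
  refine measurableSet_tendsto (𝓝 0) fun n => ?_
  exact (measurable_of_countable fun v : Site d => (n : ℝ)⁻¹ • fun i : Fin d => (v i : ℝ)).comp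
    (measurable_pi_apply n)

variable [NeZero d]

theorem dirSeqLaw_trajectory_cylinder (ω : Env d) (n : ℕ) (v : Site d) (x : Path d) :
    dirSeqLaw d {t | ∀ k ≤ n, trajectory ω v t k = x k} =
      (if x 0 = v then 1 else 0) * ∏ k ∈ Finset.range n, step ω (x k) {x (k + 1)} := by
  classical
  induction n generalizing v x with
  | zero =>
    by_cases h : x 0 = v
    · simp [trajectory, h]
    · simp [trajectory, h, Ne.symm h]
  | succ n ih =>
    have hm : MeasurableSet {t | ∀ k ≤ n + 1, trajectory ω v t k = x k} := by
      simp only [Set.ofPred_forall]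
      exact .iInter fun k => .iInter fun _ =>
        (measurable_pi_apply k).comp (measurable_trajectory ω v) (measurableSet_singleton (x k))
    have hsec : ∀ a, {t | consSeq a t ∈ {t | ∀ k ≤ n + 1, trajectory ω v t k = x k}}
        = {t | x 0 = v ∧ ∀ k ≤ n, trajectory ω (neighbor ω v a) t k = x (k + 1)} := by
      intro a
      ext t
      simp only [Set.mem_ofPred_eq]
      constructor
      · intro h
        refine ⟨(h 0 (by omega)).symm, fun k hk => ?_⟩
        rw [← h (k + 1) (by omega), trajectory_succ]
        rfl
      · rintro ⟨h0, h⟩ k hk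
        cases k with
        | zero => exact h0.symm
        | succ k =>
          rw [← h k (by omega), trajectory_succ]
          rfl
    rw [dirSeqLaw_apply hm]
    simp only [hsec]
    by_cases h0 : x 0 = v
    · subst h0
      simp only [true_and, ih _ fun k => x (k + 1), if_true, one_mul]
      rw [Finset.prod_range_succ', ← Finset.sum_mul, ← mul_assoc, mul_comm]
      congr 1
      rw [step, Measure.smul_apply, Measure.finsetSum_apply, smul_eq_mul]
      congr 1
      exact Finset.sum_congr rfl fun a _ => by simp [Set.indicator_apply, eq_comm]
    · simp [h0]

/-- The quenched walk chooses its successive directions independently and uniformly. -/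
theorem quenched_eq_map_trajectory (ω : Env d) :
    quenched ω = (dirSeqLaw d).map (trajectory ω 0) := by
  have hproj : IsProjectiveMeasureFamily fun I : Finset ℕ => (quenched ω).map I.restrict :=
    isProjectiveMeasureFamily_map_restrict (P := quenched ω) (X := fun n X => X n)
      fun n => (measurable_pi_apply n).aemeasurable
  have hlim : IsProjectiveLimit (quenched ω) fun I : Finset ℕ => (quenched ω).map I.restrict :=
    fun _ => rfl
  refine hlim.unique ((isProjectiveLimit_nat_iff hproj _).2 fun n => ?_)
  have hq : (quenched ω).map (Finset.Iic n).restrict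
      = Kernel.partialTraj (X := fun _ => Site d) (stepKernel ω) 0 n fun _ => 0 :=
    Kernel.traj_map_frestrictLe_apply (X := fun _ => Site d) 0 n fun _ => 0
  rw [hq]
  refine Measure.ext_of_singleton fun y => ?_
  have hx : ∃ x : Path d, Preorder.frestrictLe n x = y :=
    ⟨fun k => if hk : k ∈ Finset.Iic n then y ⟨k, hk⟩ else 0, by
      ext1 ⟨k, hk⟩
      simp only [Preorder.frestrictLe, Finset.restrict]
      exact dif_pos hk⟩
  obtain ⟨x, rfl⟩ := hx
  rw [partialTraj_singleton, ← dirSeqLaw_trajectory_cylinder,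
    Measure.map_map (by fun_prop) (measurable_trajectory ω 0),
    Measure.map_apply ((Preorder.measurable_frestrictLe n).comp (measurable_trajectory ω 0))
      (measurableSet_singleton _)]
  congr 1
  ext t
  simp [funext_iff, Preorder.frestrictLe]

instance : IsMarkovKernel (quenchedKernel d) :=
  ⟨fun ω => inferInstanceAs (IsProbabilityMeasure (quenched ω))⟩

theorem IsPointProcess.ae_annealed_tendsto {Q : Measure (Env d)} (hQ : IsPointProcess Q) :
    ∀ᵐ X ∂annealed Q,
      Tendsto (fun n : ℕ => (n : ℝ)⁻¹ • (fun i : Fin d => (X n i : ℝ))) atTop (𝓝 0) := by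
  have := hQ.isProbabilityMeasure_palm
  have hlim : ∀ᵐ ω ∂palm Q, ∀ᵐ t ∂dirSeqLaw d, ∀ i : Fin d,
      Tendsto (fun n : ℕ => (n : ℝ)⁻¹ * birkhoffSum skew (displacement i) n (ω, t)) atTop (𝓝 0) :=
    Measure.ae_ae_of_ae_prod (ae_all_iff.2 fun i => ae_tendsto_birkhoffSum_div hQ.ergodic_skew
      (measurable_displacement i) (hQ.integrable_displacement i) (hQ.integral_displacement i))
  rw [annealed, jointLaw, Measure.snd_compProd]
  refine Measure.ae_comp_of_ae_ae measurableSet_tendsto_div ?_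
  filter_upwards [hlim] with ω hω
  change ∀ᵐ X ∂quenched ω, _
  rw [quenched_eq_map_trajectory, ae_map_iff (measurable_trajectory ω 0).aemeasurable
    measurableSet_tendsto_div]
  filter_upwards [hω] with t ht
  refine tendsto_pi_nhds.2 fun i => ?_
  simpa [trajectory_eq_birkhoffSum, shift_zero] using ht i

end Trajectory

end PointProcessWalk

theorem theorem1p9 (d : ℕ) [NeZero d] (Q : Measure (PointProcessWalk.Env d))
    (hQ : PointProcessWalk.IsPointProcess Q) :
    PointProcessWalk.annealed Q
        {X | Tendsto (fun n : ℕ => (n : ℝ)⁻¹ • (fun i : Fin d => (X n i : ℝ))) atTop (𝓝 0)} = 1 ∧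
      ∀ e : PointProcessWalk.Dir d,
        ∫⁻ ω, (PointProcessWalk.coordDist e ω : ℝ≥0∞) ∂(PointProcessWalk.palm Q) < ∞ := by
  have := hQ.isProbabilityMeasure_palm
  refine ⟨?_, hQ.lintegral_coordDist_lt_top⟩
  have : IsProbabilityMeasure (PointProcessWalk.annealed Q) := by
    unfold PointProcessWalk.annealed PointProcessWalk.jointLaw
    infer_instance
  exact (prob_compl_eq_zero_iff PointProcessWalk.measurableSet_tendsto_div).1
    hQ.ae_annealed_tendsto
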